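/- Let $n,k\ge 0$ be integers, not both $0$, and let $\Sigma$ be a totally ordered alphabet with $|\Sigma|=k$. The suffix array of a word $w=w_1\cdots w_n\in\Sigma^n$ is the permutation $\pi\in S_n$ such that $\pi(i)=j$ iff $w_j\cdots w_n$ is the $i$-th in the lexicographic ordering of the suffixes $w_1\cdots w_n,\ w_2\cdots w_n,\ \dots,\ w_n$ (a proper prefix of a word precedes the word). For $\pi\in S_m$ let $\mathrm{Des}(\pi)=\{i\in[1,m-1]:\pi(i)>\pi(i+1)\}$. Let $\left\langle {n\atop d}\right\rangle$ be the Eulerian number, i.e. the number of $\pi\in S_n$ with $|\mathrm{Des}(\pi)|=d$. Let $S_{m}^c$ $(m\ge 1)$ be the set of permutations in $S_m$ with exactly one orbit, put $\delta(\varphi)=|\mathrm{Des}(\varphi)\setminus\{1\}|$, and let $P(m,d)$ be the number of $\varphi\in S_{m+1}^c$ with $\delta(\varphi)=d$ (so $P(m,-1)=0$). For $s\in[2,n+2]$ let $A_s(i)=i$ if $i<s$ and $A_s(i)=i+1$ if $i\ge s$, and for $\varphi\in S_{n+1}$ let $T_s(\varphi)\in S_{n+2}$ be given by $T_s(\varphi)(1)=s$,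 $T_s(\varphi)(s)=A_s(\varphi(1))$ and $T_s(\varphi)(A_s(j))=A_s(\varphi(j))$ for $j\in[2,n+1]$. Theorem. 1. The number of permutations $\pi\in S_n$ that are the suffix array of some word $w\in\Sigma^n$ is $\sum_{d=0}^{k-1}\left\langle {n\atop d}\right\rangle$. 2. $P(n,d)=\left\langle {n\atop d}\right\rangle$ for all $d\ge 0$. Moreover $P(1,0)=1$, $P(1,d)=0$ for $d\ge 1$, and the Eulerian recurrence $P(n+1,d)=(d+1)\,P(n,d)+(n+1-d)\,P(n,d-1)$ holds for all $d\ge 0$. 3. The map $(s,\varphi)\mapsto T_s(\varphi)$ is a bijection from $[2,n+2]\times S_{n+1}^c$ onto $S_{n+2}^c$. For every $\varphi\in S_{n+1}^c$ and every $s\in[2,n+2]$ one has $\delta(T_s(\varphi))\in\{\delta(\varphi),\delta(\varphi)+1\}$, and $\delta(T_s(\varphi))=\delta(\varphi)$ for exactly $\delta(\varphi)+1$ values of $s$. -/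

import Mathlib

open Equiv

namespace SuffixArrays

/-! Permutations in `S_n` are elements of `Perm (Fin n)`; the positions and values `1, …, n` are
represented by `0, …, n - 1`. In particular the position `1` is represented by `0`. -/

/-- The suffix of the word `w` that starts at position `j` and runs to the end of `w`. -/
def suffix {α : Type*} {n : ℕ} (w : Fin n → α) (j : Fin n) : List α :=
  (List.ofFn w).drop j

/-- `π` is the suffix array of `w`: the suffix starting at `π i` is the `i`-th one when all the
(nonempty) suffixes of `w` are listed in increasing lexicographic order. The order `<` on lists is
the lexicographic one, in which a proper prefix precedes the longer word. -/
def IsSuffixArray {α : Type*} [LinearOrder α] {n : ℕ} (w : Fin n → α) (π : Perm (Fin n)) : Prop :=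
  StrictMono fun i => suffix w (π i)

/-- The descent set of a permutation: the positions `i`, other than the last one, with
`π (i + 1) < π i`. -/
def Des {n : ℕ} (π : Perm (Fin n)) : Finset (Fin n) :=
  Finset.univ.filter fun i => ∃ h : (i : ℕ) + 1 < n, π ⟨i + 1, h⟩ < π i

/-- The Eulerian number: the number of permutations in `S_n` with exactly `d` descents. -/
noncomputable def eulerian (n d : ℕ) : ℕ :=
  Nat.card {π : Perm (Fin n) // (Des π).card = d}

/-- `φ` has exactly one orbit on the nonempty set `Fin (n + 1)`. The identity of a one-point set
qualifies. -/
def OneOrbit {n : ℕ} (φ : Perm (Fin (n + 1))) : Prop :=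
  ∀ i j, φ.SameCycle i j

/-- The number of descents of `φ` other than the first position. -/
def desTail {n : ℕ} (φ : Perm (Fin (n + 1))) : ℕ :=
  ((Des φ).erase 0).card

/-- The number of one-orbit permutations in `S_{n+1}` with exactly `d` descents other than the
first position. -/
noncomputable def oneOrbitCount (n d : ℕ) : ℕ :=
  Nat.card {φ : Perm (Fin (n + 1)) // OneOrbit φ ∧ desTail φ = d}

/-- The insertion map `T_s`. With `A = s.succAbove` the increasing map that skips the value `s`,
`φ.extendDomain` is `A ∘ φ ∘ A⁻¹` off `s` and fixes `s`; the arrow `0 ↦ A (φ 0)` is then replaced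
by `0 ↦ s ↦ A (φ 0)`. See `insertAt_zero`, `insertAt_self` and `insertAt_succAbove`. -/
def insertAt {n : ℕ} (s : Fin (n + 2)) (φ : Perm (Fin (n + 1))) : Perm (Fin (n + 2)) :=
  φ.extendDomain (finSuccAboveEquiv s) * swap 0 s

theorem extendDomain_succAbove {n : ℕ} (s : Fin (n + 2)) (φ : Perm (Fin (n + 1)))
    (j : Fin (n + 1)) :
    φ.extendDomain (finSuccAboveEquiv s) (s.succAbove j) = s.succAbove (φ j) :=
  φ.extendDomain_apply_image (finSuccAboveEquiv s) j

theorem insertAt_zero {n : ℕ} (s : Fin (n + 2)) (φ : Perm (Fin (n + 1))) :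
    insertAt s φ 0 = s := by
  simp [insertAt, Perm.extendDomain_apply_not_subtype]

theorem insertAt_self {n : ℕ} {s : Fin (n + 2)} (hs : s ≠ 0) (φ : Perm (Fin (n + 1))) :
    insertAt s φ s = s.succAbove (φ 0) := by
  have h := extendDomain_succAbove s φ 0
  rw [Fin.succAbove_ne_zero_zero hs] at h
  simp [insertAt, h]

theorem insertAt_succAbove {n : ℕ} {s : Fin (n + 2)} (hs : s ≠ 0) (φ : Perm (Fin (n + 1)))
    {j : Fin (n + 1)} (hj : j ≠ 0) :
    insertAt s φ (s.succAbove j) = s.succAbove (φ j) := by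
  have h0 : s.succAbove j ≠ 0 := Fin.succAbove_ne_zero hs hj
  rw [insertAt, Perm.mul_apply, swap_apply_of_ne_of_ne h0 (Fin.succAbove_ne s j),
    extendDomain_succAbove]

end SuffixArrays

/-!
The Eulerian recurrence governs insertion. When a new letter `c` is inserted into a sequence `u` of
distinct letters, the number of descents stays the same or grows by one, and it stays the same for
exactly `des u + 1` places, whatever `c` is (`descents_insertNth`, `card_descents_insertNth`).
Inserting the largest value into the one-line notation of a permutation of `Fin n` therefore gives
the Eulerian recurrence (`eulerian_recurrence`). On the positions other than the first, the map
`T_s` is an insertion as well: it places the letter `φ 0` into the sequence `φ 1, …, φ n` and then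
relabels monotonically (`desTail_insertAt_succ`). Since `T_s` inserts the new point `s` into the
cycle through `0`, it preserves the property of having one orbit, and every one-orbit permutation
`ψ` arises, from `s = ψ 0`, exactly once (`insertAt_bijOn`). So the one-orbit permutations, counted
by the descents outside the first position, satisfy the same recurrence with the same initial
values as the Eulerian numbers.

For suffix arrays, rank the `n + 1` suffixes of a word, the empty one included, and let `rankStep π`
be the permutation of the ranks induced by removing the first letter, the empty suffix being
followed by the whole word. It is a conjugate of a cyclic rotation, so it has one orbit, and it
determines `π`; as there are `n!` one-orbit permutations of `n + 1` points, `π ↦ rankStep π` is a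
bijection onto them (`rankStep_bijective`). Comparing suffixes by their first letters and then by
the ranks of the rests (`isSuffixArray_iff`), one sees that `π` is the suffix array of `w` iff the
first letters of the sorted suffixes increase weakly, and strictly at each descent of `rankStep π`
outside the first position. Such a word over `k` letters exists iff there are fewer than `k` of
these descents (`exists_isSuffixArray_iff`).
-/

open Equiv

namespace SuffixArrays

/-! ### Descents of finite sequences -/

/-- The number of descents of the sequence `f`, that is, of the positions `i`, other than the last
one, with `f (i + 1) < f i`. -/
def descents {L : Type*} [LinearOrder L] {n : ℕ} (f : Fin n → L) : ℕ :=
  (Finset.univ.filter fun i : Fin n => ∃ h : (i : ℕ) + 1 < n, f ⟨i + 1, h⟩ < f i).card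

theorem descents_cons {L : Type*} [LinearOrder L] {n : ℕ} (a : L) (f : Fin (n + 1) → L) :
    descents (Fin.cons a f : Fin (n + 2) → L) = (if f 0 < a then 1 else 0) + descents f := by
  unfold descents
  rw [Finset.card_filter, Fin.sum_univ_succ, Finset.card_filter]
  congr 1
  · refine if_congr ⟨fun ⟨_, h⟩ => h, fun h => ⟨by simp, h⟩⟩ rfl rfl
  · refine Finset.sum_congr rfl fun i _ => if_congr ?_ rfl rfl
    exact ⟨fun ⟨h, h'⟩ => ⟨by simpa using h, h'⟩, fun ⟨h, h'⟩ => ⟨by simpa using h, h'⟩⟩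

theorem descents_of_le_one {L : Type*} [LinearOrder L] {n : ℕ} (hn : n ≤ 1) (f : Fin n → L) :
    descents f = 0 := by
  refine Finset.card_eq_zero.2 (Finset.filter_eq_empty_iff.2 ?_)
  rintro i - ⟨h, -⟩
  omega

theorem descents_comp {L M : Type*} [LinearOrder L] [LinearOrder M] {n : ℕ} {g : L → M}
    (hg : StrictMono g) (f : Fin n → L) : descents (fun i => g (f i)) = descents f := by
  simp only [descents, hg.lt_iff_lt]

theorem card_Des {n : ℕ} (π : Perm (Fin n)) : (Des π).card = descents π := rfl

theorem desTail_eq_descents {n : ℕ} (φ : Perm (Fin (n + 1))) :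
    desTail φ = descents fun i : Fin n => φ i.succ := by
  have h : (Des φ).erase 0 = Finset.univ.filter fun i : Fin (n + 1) =>
      i ≠ 0 ∧ ∃ h : (i : ℕ) + 1 < n + 1, φ ⟨i + 1, h⟩ < φ i := by
    ext i
    simp [Des]
  rw [desTail, h, descents, Finset.card_filter, Fin.sum_univ_succ, Finset.card_filter]
  simp only [ne_eq, not_true_eq_false, false_and, if_false, zero_add]
  refine Finset.sum_congr rfl fun i _ => if_congr ?_ rfl rfl
  exact ⟨fun ⟨_, h, h'⟩ => ⟨by simpa using h, h'⟩,
    fun ⟨h, h'⟩ => ⟨Fin.succ_ne_zero i, by simpa using h, h'⟩⟩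

/-! ### Inserting a letter into a sequence -/

/-- Inserting `c` into `u`, when a letter `a` stands in front of `u`. The letter `a` makes the
induction work: if `c < a`, one of the places that preserve the number of descents is lost, namely
the one in front of the whole word `a, u`. -/
theorem descents_cons_insertNth {L : Type*} [LinearOrder L] (c : L) {n : ℕ} (a : L) (u : Fin n → L)
    (hca : c ≠ a) (hcu : ∀ i, c ≠ u i) :
    (∀ p : Fin (n + 1),
      descents (Fin.cons a (Fin.insertNth p c u) : Fin (n + 2) → L) =
        descents (Fin.cons a u : Fin (n + 1) → L) ∨
      descents (Fin.cons a (Fin.insertNth p c u) : Fin (n + 2) → L) =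
        descents (Fin.cons a u : Fin (n + 1) → L) + 1) ∧
    (Finset.univ.filter fun p : Fin (n + 1) =>
      descents (Fin.cons a (Fin.insertNth p c u) : Fin (n + 2) → L) =
        descents (Fin.cons a u : Fin (n + 1) → L)).card + (if c < a then 1 else 0) =
      descents (Fin.cons a u : Fin (n + 1) → L) + 1 := by
  induction n generalizing a with
  | zero =>
    have h0 : descents (Fin.cons a u : Fin 1 → L) = 0 := descents_of_le_one le_rfl _
    have h1 (p : Fin 1) : descents (Fin.cons a (Fin.insertNth p c u) : Fin 2 → L) =
        if c < a then 1 else 0 := by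
      rw [descents_cons, descents_of_le_one le_rfl, add_zero, Subsingleton.elim p 0,
        Fin.insertNth_zero', Fin.cons_zero]
    by_cases h : c < a <;> simp [h0, h1, h]
  | succ n ih =>
    obtain ⟨b, v, rfl⟩ : ∃ b v, u = (Fin.cons b v : Fin (n + 1) → L) :=
      ⟨u 0, Fin.tail u, (Fin.cons_self_tail u).symm⟩
    have hcb : c ≠ b := hcu 0
    obtain ⟨ih1, ih2⟩ := ih b v hcb fun i => hcu i.succ
    have h0 : descents (Fin.cons a (Fin.insertNth 0 c (Fin.cons b v : Fin (n + 1) → L)) :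
        Fin (n + 3) → L) = (if c < a then 1 else 0) +
          ((if b < c then 1 else 0) + descents (Fin.cons b v : Fin (n + 1) → L)) := by
      rw [descents_cons, Fin.insertNth_zero', descents_cons, Fin.cons_zero, Fin.cons_zero]
    have hs (p : Fin (n + 1)) : descents (Fin.cons a (Fin.insertNth p.succ c
        (Fin.cons b v : Fin (n + 1) → L)) : Fin (n + 3) → L) = (if b < a then 1 else 0) +
          descents (Fin.cons b (Fin.insertNth p c v) : Fin (n + 2) → L) := by
      rw [descents_cons, Fin.insertNth_succ_cons, Fin.cons_zero]
    have ha : descents (Fin.cons a (Fin.cons b v : Fin (n + 1) → L) : Fin (n + 2) → L) =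
        (if b < a then 1 else 0) + descents (Fin.cons b v : Fin (n + 1) → L) := by
      rw [descents_cons, Fin.cons_zero]
    -- the comparisons among `a`, `b`, `c` are all that matters at the front
    have key : (c < a ∧ b < c ∧ b < a) ∨ (c < a ∧ ¬ b < c ∧ b < a) ∨ (c < a ∧ ¬ b < c ∧ ¬ b < a) ∨
        (¬ c < a ∧ b < c ∧ b < a) ∨ (¬ c < a ∧ b < c ∧ ¬ b < a) ∨
        (¬ c < a ∧ ¬ b < c ∧ ¬ b < a) := by
      by_cases h1 : c < a <;> by_cases h2 : b < c <;> by_cases h3 : b < a <;> simp [h1, h2, h3]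
      · exact h3 (h2.trans h1)
      · exact h2 (h3.trans_le (not_lt.1 h1))
    have hbc : c < b ↔ ¬ b < c := ⟨fun h => h.not_gt, fun h => lt_of_le_of_ne (not_lt.1 h) hcb⟩
    constructor
    · intro p
      refine Fin.cases ?_ (fun p => ?_) p
      · rw [h0, ha]
        rcases key with ⟨h1, h2, h3⟩ | ⟨h1, h2, h3⟩ | ⟨h1, h2, h3⟩ | ⟨h1, h2, h3⟩ | ⟨h1, h2, h3⟩ |
          ⟨h1, h2, h3⟩ <;> simp only [h1, h2, h3, if_true, if_false] <;> omega
      · rw [hs, ha]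
        rcases ih1 p with h | h <;> rw [h] <;> omega
    · rw [Finset.card_filter] at ih2 ⊢
      rw [Fin.sum_univ_succ]
      simp only [h0, hs, ha, add_right_inj]
      rcases key with ⟨h1, h2, h3⟩ | ⟨h1, h2, h3⟩ | ⟨h1, h2, h3⟩ | ⟨h1, h2, h3⟩ | ⟨h1, h2, h3⟩ |
        ⟨h1, h2, h3⟩ <;>
      simp only [hbc, h1, h2, h3, if_true, if_false, not_true_eq_false,
        not_false_eq_true] at ih2 ⊢ <;>
      split_ifs <;> omega

/-- Inserting a new letter `c` into a sequence adds at most one descent. -/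
theorem descents_insertNth {L : Type*} [LinearOrder L] (c : L) {n : ℕ} (u : Fin n → L)
    (hcu : ∀ i, c ≠ u i) (p : Fin (n + 1)) :
    descents (Fin.insertNth p c u : Fin (n + 1) → L) = descents u ∨
      descents (Fin.insertNth p c u : Fin (n + 1) → L) = descents u + 1 := by
  cases n with
  | zero => simp [descents_of_le_one]
  | succ n =>
    obtain ⟨b, v, rfl⟩ : ∃ b v, u = (Fin.cons b v : Fin (n + 1) → L) :=
      ⟨u 0, Fin.tail u, (Fin.cons_self_tail u).symm⟩
    refine Fin.cases ?_ (fun p => ?_) p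
    · rw [Fin.insertNth_zero', descents_cons, Fin.cons_zero]
      split_ifs <;> omega
    · rw [Fin.insertNth_succ_cons]
      exact (descents_cons_insertNth c b v (hcu 0) fun i => hcu i.succ).1 p

/-- The number of places where a new letter `c` can be inserted without creating a descent depends
neither on `c` nor on the sequence beyond its number of descents: framed by `-∞` and `∞`, the
sequence crosses the level `c` once more upwards than downwards; a place that preserves the number
of descents is an upward crossing or a descent that is not a downward crossing. -/
theorem card_descents_insertNth {L : Type*} [LinearOrder L] (c : L) {n : ℕ} (u : Fin n → L)
    (hcu : ∀ i, c ≠ u i) :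
    (Finset.univ.filter fun p : Fin (n + 1) =>
      descents (Fin.insertNth p c u : Fin (n + 1) → L) = descents u).card = descents u + 1 := by
  cases n with
  | zero => simp [descents_of_le_one]
  | succ n =>
    obtain ⟨b, v, rfl⟩ : ∃ b v, u = (Fin.cons b v : Fin (n + 1) → L) :=
      ⟨u 0, Fin.tail u, (Fin.cons_self_tail u).symm⟩
    have hcb : c ≠ b := hcu 0
    have h := (descents_cons_insertNth c b v hcb fun i => hcu i.succ).2
    rw [Finset.card_filter] at h ⊢
    rw [Fin.sum_univ_succ]
    simp only [Fin.insertNth_zero', Fin.insertNth_succ_cons]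
    rw [← h, add_comm, descents_cons, Fin.cons_zero]
    rcases lt_or_gt_of_ne hcb with hlt | hlt
    · simp [hlt, hlt.not_gt]
    · simp [hlt, hlt.not_gt]

/-! ### The recurrence for a statistic under insertion -/

/-- If every element of `Y` arises exactly once from an element `x` of `X` by one of `N` insertions,
of which `δ x + 1` preserve the statistic `δ` and the others increase it by one, then the numbers of
elements of `X` and `Y` with given values of the statistic satisfy the Eulerian recurrence. -/
theorem card_insertion_recurrence {N : ℕ} {X Y : Type*} [Finite X] {e : Fin N × X → Y}
    (he : Function.Bijective e) {δ : X → ℕ} {ε : Y → ℕ}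
    (h₁ : ∀ p x, ε (e (p, x)) = δ x ∨ ε (e (p, x)) = δ x + 1)
    (h₂ : ∀ x, (Finset.univ.filter fun p => ε (e (p, x)) = δ x).card = δ x + 1) :
    Nat.card {y // ε y = 0} = Nat.card {x // δ x = 0} ∧
    ∀ d, (Nat.card {y // ε y = d + 1} : ℤ) = (d + 2) * Nat.card {x // δ x = d + 1} +
      ((N : ℤ) - (d + 1)) * Nat.card {x // δ x = d} := by
  classical
  have := Fintype.ofFinite X
  have hY (d : ℕ) : Nat.card {y // ε y = d} =
      ∑ x, (Finset.univ.filter fun p => ε (e (p, x)) = d).card := by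
    rw [← Nat.card_congr ((Equiv.ofBijective e he).subtypeEquiv (p := fun a => ε (e a) = d)
        fun a => Iff.rfl),
      Nat.card_eq_fintype_card, Fintype.card_subtype, Finset.card_filter,
      Fintype.sum_prod_type_right]
    simp only [Finset.card_filter]
  have hX (d : ℕ) : Nat.card {x // δ x = d} = ∑ x, if δ x = d then 1 else 0 := by
    rw [Nat.card_eq_fintype_card, Fintype.card_subtype, Finset.card_filter]
  -- the insertions that do not preserve the statistic
  have h₃ (x : X) :
      ((Finset.univ.filter fun p => ε (e (p, x)) = δ x + 1).card : ℤ) = N - (δ x + 1) := by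
    have h := Finset.card_filter_add_card_filter_not (s := (Finset.univ : Finset (Fin N)))
      (fun p => ε (e (p, x)) = δ x)
    rw [h₂, Finset.card_univ, Fintype.card_fin] at h
    have h' : (Finset.univ.filter fun p => ¬ ε (e (p, x)) = δ x) =
        Finset.univ.filter fun p => ε (e (p, x)) = δ x + 1 :=
      Finset.filter_congr fun p _ => by rcases h₁ p x with h | h <;> rw [h] <;> omega
    rw [h'] at h
    omega
  have h₄ {x : X} {d : ℕ} (h : d ≠ δ x) (h' : d ≠ δ x + 1) :
      (Finset.univ.filter fun p => ε (e (p, x)) = d).card = 0 := by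
    refine Finset.card_eq_zero.2 (Finset.filter_eq_empty_iff.2 fun p _ hp => ?_)
    rcases h₁ p x with h'' | h'' <;> omega
  refine ⟨?_, fun d => ?_⟩
  · rw [hY, hX]
    refine Finset.sum_congr rfl fun x _ => ?_
    split_ifs with h
    · rw [← h, h₂, h]
    · exact h₄ (Ne.symm h) (by omega)
  · rw [hY, hX, hX]
    push_cast
    rw [Finset.mul_sum, Finset.mul_sum, ← Finset.sum_add_distrib]
    refine Finset.sum_congr rfl fun x _ => ?_
    by_cases h : δ x = d + 1
    · rw [← h, h₂, if_pos rfl, if_neg (by omega), h]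
      push_cast
      ring
    · by_cases h' : δ x = d
      · rw [← h', h₃, if_neg (by omega), if_pos rfl]
        ring
      · rw [h₄ (by omega) (by omega), if_neg h, if_neg h']
        simp

/-! ### The recurrence for the Eulerian numbers -/

/-- The permutation of `Fin (n + 1)` whose one-line notation is obtained from that of `φ` by
inserting the largest value at the place `p`. -/
def insertLast {n : ℕ} (p : Fin (n + 1)) (φ : Perm (Fin n)) : Perm (Fin (n + 1)) :=
  ((finSuccEquiv' p).trans (optionCongr φ)).trans finSuccEquivLast.symm

theorem coe_insertLast {n : ℕ} (p : Fin (n + 1)) (φ : Perm (Fin n)) :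
    (insertLast p φ : Fin (n + 1) → Fin (n + 1)) =
      Fin.insertNth p (Fin.last n) fun i => (φ i).castSucc := by
  ext1 j
  refine Fin.succAboveCases p ?_ (fun j => ?_) j
  · simp [insertLast]
  · simp [insertLast]

theorem insertLast_bijective (n : ℕ) :
    Function.Bijective fun q : Fin (n + 1) × Perm (Fin n) => insertLast q.1 q.2 := by
  rw [Fintype.bijective_iff_injective_and_card]
  refine ⟨?_, by simp [Fintype.card_perm, Nat.factorial_succ]⟩
  rintro ⟨p, φ⟩ ⟨q, ψ⟩ (h : insertLast p φ = insertLast q ψ)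
  have hl (p : Fin (n + 1)) (φ : Perm (Fin n)) : insertLast p φ p = Fin.last n := by
    simp [coe_insertLast]
  obtain rfl : p = q := (insertLast q ψ).injective (by rw [hl, ← h, hl])
  refine Prod.ext rfl (Equiv.ext fun i => ?_)
  simpa [coe_insertLast] using congrArg (fun σ => σ (p.succAbove i)) h

theorem eulerian_recurrence (n : ℕ) :
    eulerian (n + 1) 0 = eulerian n 0 ∧
    ∀ d, (eulerian (n + 1) (d + 1) : ℤ) =
      (d + 2) * eulerian n (d + 1) + ((n : ℤ) - d) * eulerian n d := by
  have hne (φ : Perm (Fin n)) (i : Fin n) : Fin.last n ≠ (φ i).castSucc :=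
    (Fin.castSucc_lt_last _).ne'
  have hφ (φ : Perm (Fin n)) : (Des φ).card = descents fun i => (φ i).castSucc :=
    (descents_comp Fin.strictMono_castSucc φ).symm
  have h := card_insertion_recurrence (insertLast_bijective n) (δ := fun φ => (Des φ).card)
    (ε := fun ψ => (Des ψ).card)
    (fun p φ => by
      simp only [hφ φ, card_Des (insertLast p φ), coe_insertLast]
      exact descents_insertNth _ _ (hne φ) p)
    (fun φ => by
      simp only [hφ φ, card_Des (insertLast _ φ), coe_insertLast]
      exact card_descents_insertNth _ _ (hne φ))
  refine ⟨h.1, fun d => (h.2 d).trans ?_⟩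
  simp only [eulerian]
  push_cast
  ring

/-! ### The insertion maps on one-orbit permutations -/

/-- A map that sends each step of `f` into an orbit of `g` sends orbits into orbits. -/
theorem _root_.Equiv.Perm.SameCycle.map_of_apply {A B : Type*} {f : Perm A} {g : Perm B} {r : A → B}
    (h : ∀ x, g.SameCycle (r x) (r (f x))) {x y : A} (hxy : f.SameCycle x y) :
    g.SameCycle (r x) (r y) := by
  obtain ⟨i, rfl⟩ := hxy
  induction i with
  | zero => exact Perm.SameCycle.refl _ _
  | succ i ih =>
    rw [add_comm, zpow_add, zpow_one]
    exact ih.trans (h _)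
  | pred i ih =>
    refine ih.trans (Perm.SameCycle.symm ?_)
    have h' := h ((f ^ (-(i : ℤ) - 1)) x)
    rwa [← Perm.mul_apply, ← zpow_one_add, add_sub_cancel] at h'

/-- Inserting `s` into the cycle of `0` neither splits nor joins orbits. -/
theorem oneOrbit_insertAt {n : ℕ} {s : Fin (n + 2)} (hs : s ≠ 0) (φ : Perm (Fin (n + 1))) :
    OneOrbit (insertAt s φ) ↔ OneOrbit φ := by
  have h0 : s.succAbove 0 = 0 := Fin.succAbove_ne_zero_zero hs
  constructor
  · intro h i j
    -- the retraction that undoes the insertion by sending `s` to `0`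
    let r : Fin (n + 2) → Fin (n + 1) := Fin.insertNth s 0 id
    have hr (i : Fin (n + 1)) : r (s.succAbove i) = i := by simp [r]
    have hrs : r s = 0 := by simp [r]
    have hr0 : r 0 = 0 := by rw [← h0, hr]
    rw [← hr i, ← hr j]
    refine Perm.SameCycle.map_of_apply (fun x => ?_) (h _ _)
    refine Fin.succAboveCases s ?_ (fun k => ?_) x
    · rw [insertAt_self hs, hr, hrs]
      exact Perm.sameCycle_apply_right.2 (Perm.SameCycle.refl _ _)
    · by_cases hk : k = 0
      · rw [hk, h0, insertAt_zero, hrs, hr0]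
      · rw [insertAt_succAbove hs φ hk, hr, hr]
        exact Perm.sameCycle_apply_right.2 (Perm.SameCycle.refl _ _)
  · intro h
    have hs0 : (insertAt s φ).SameCycle s 0 := by
      have := (Perm.SameCycle.refl (insertAt s φ) 0)
      rwa [← Perm.sameCycle_apply_left, insertAt_zero] at this
    have hA (i j : Fin (n + 1)) : (insertAt s φ).SameCycle (s.succAbove i) (s.succAbove j) := by
      refine Perm.SameCycle.map_of_apply (fun k => ?_) (h i j)
      by_cases hk : k = 0
      · rw [hk, h0, ← insertAt_self hs]
        exact Perm.sameCycle_apply_right.2 hs0.symm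
      · rw [← insertAt_succAbove hs φ hk]
        exact Perm.sameCycle_apply_right.2 (Perm.SameCycle.refl _ _)
    have hA0 (x : Fin (n + 2)) : (insertAt s φ).SameCycle x 0 := by
      refine Fin.succAboveCases s hs0 (fun k => ?_) x
      simpa only [h0] using hA k 0
    exact fun x y => (hA0 x).trans (hA0 y).symm

theorem insertAt_surjective {n : ℕ} (ψ : Perm (Fin (n + 2))) : ∃ φ, insertAt (ψ 0) φ = ψ := by
  set s := ψ 0 with hs
  -- undoing the last step of the insertion leaves a permutation that fixes `s`
  have hfix (x : Fin (n + 2)) : (ψ * swap 0 s) x ≠ s ↔ x ≠ s := by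
    have h : (ψ * swap 0 s) s = s := by simp [hs]
    have h' := (ψ * swap 0 s).injective.ne_iff (x := x) (y := s)
    rwa [h] at h'
  refine ⟨(finSuccAboveEquiv s).symm.permCongr ((ψ * swap 0 s).subtypePerm hfix), ?_⟩
  rw [insertAt, ← eq_mul_inv_iff_mul_eq, swap_inv]
  ext1 x
  refine Fin.succAboveCases s ?_ (fun k => ?_) x
  · rw [Perm.extendDomain_apply_not_subtype _ _ (by simp)]
    simp [hs]
  · rw [extendDomain_succAbove]
    have h (y : {x // x ≠ s}) : s.succAbove ((finSuccAboveEquiv s).symm y) = y :=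
      congrArg Subtype.val ((finSuccAboveEquiv s).apply_symm_apply y)
    exact h _

theorem insertAt_injective {n : ℕ} {s t : Fin (n + 2)} {φ ψ : Perm (Fin (n + 1))}
    (h : insertAt s φ = insertAt t ψ) : s = t ∧ φ = ψ := by
  obtain rfl : s = t := by rw [← insertAt_zero s φ, h, insertAt_zero]
  refine ⟨rfl, Equiv.ext fun i => s.succAbove_right_injective ?_⟩
  rw [← extendDomain_succAbove, ← extendDomain_succAbove, mul_right_cancel h]

theorem insertAt_bijOn (n : ℕ) :
    Set.BijOn (fun p : Fin (n + 2) × Perm (Fin (n + 1)) => insertAt p.1 p.2)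
      {p | p.1 ≠ 0 ∧ OneOrbit p.2} {ψ | OneOrbit ψ} := by
  refine ⟨fun p hp => (oneOrbit_insertAt hp.1 p.2).2 hp.2, fun p _ q _ h => ?_, fun ψ hψ => ?_⟩
  · obtain ⟨h₁, h₂⟩ := insertAt_injective h
    exact Prod.ext h₁ h₂
  · obtain ⟨φ, hφ⟩ := insertAt_surjective ψ
    have h0 : ψ 0 ≠ 0 := by
      exact fun h => Fin.zero_ne_one (Perm.SameCycle.eq_of_left (hψ 0 1) h)
    refine ⟨(ψ 0, φ), ⟨h0, (oneOrbit_insertAt h0 φ).1 ?_⟩, hφ⟩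
    rwa [hφ]

/-- Off the first position, `T_s` inserts the letter `φ 0` into the sequence of the other values of
`φ` and then renames the letters in an order-preserving way. -/
theorem desTail_insertAt_succ {n : ℕ} (t : Fin (n + 1)) (φ : Perm (Fin (n + 1))) :
    desTail (insertAt t.succ φ) =
      descents (Fin.insertNth t (φ 0) fun i : Fin n => φ i.succ : Fin (n + 1) → Fin (n + 1)) := by
  rw [desTail_eq_descents, ← descents_comp (Fin.strictMono_succAbove t.succ)]
  congr 1
  ext1 j
  refine Fin.succAboveCases t ?_ (fun i => ?_) j
  · rw [insertAt_self (Fin.succ_ne_zero t), Fin.insertNth_apply_same]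
  · rw [Fin.insertNth_apply_succAbove, ← Fin.succ_succAbove_succ,
      insertAt_succAbove (Fin.succ_ne_zero t) φ (Fin.succ_ne_zero i)]

theorem desTail_insertAt_eq_or {n : ℕ} (φ : Perm (Fin (n + 1))) (t : Fin (n + 1)) :
    desTail (insertAt t.succ φ) = desTail φ ∨ desTail (insertAt t.succ φ) = desTail φ + 1 := by
  rw [desTail_insertAt_succ, desTail_eq_descents φ]
  exact descents_insertNth _ _ (fun i => φ.injective.ne (Fin.succ_ne_zero i).symm) t

theorem card_desTail_insertAt_eq {n : ℕ} (φ : Perm (Fin (n + 1))) :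
    (Finset.univ.filter fun t : Fin (n + 1) =>
      desTail (insertAt t.succ φ) = desTail φ).card = desTail φ + 1 := by
  simp only [desTail_insertAt_succ, desTail_eq_descents φ]
  exact card_descents_insertNth _ _ fun i => φ.injective.ne (Fin.succ_ne_zero i).symm

theorem insertAt_bijective (n : ℕ) :
    Function.Bijective fun q : Fin (n + 1) × {φ : Perm (Fin (n + 1)) // OneOrbit φ} =>
      (⟨insertAt q.1.succ q.2, (oneOrbit_insertAt (Fin.succ_ne_zero _) _).2 q.2.2⟩ :
        {ψ : Perm (Fin (n + 2)) // OneOrbit ψ}) := by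
  constructor
  · rintro ⟨s, φ⟩ ⟨t, ψ⟩ h
    obtain ⟨h₁, h₂⟩ := insertAt_injective (congrArg Subtype.val h)
    exact Prod.ext (Fin.succ_injective _ h₁) (Subtype.ext h₂)
  · rintro ⟨ψ, hψ⟩
    obtain ⟨⟨s, φ⟩, ⟨hs, hφ⟩, rfl⟩ := (insertAt_bijOn n).surjOn hψ
    obtain ⟨t, rfl⟩ := Fin.exists_succ_eq.2 hs
    exact ⟨(t, ⟨φ, hφ⟩), rfl⟩

theorem oneOrbitCount_eq_card (n d : ℕ) : oneOrbitCount n d =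
    Nat.card {φ : {φ : Perm (Fin (n + 1)) // OneOrbit φ} // desTail φ.1 = d} :=
  (Nat.card_congr (Equiv.subtypeSubtypeEquivSubtypeInter _ fun φ => desTail φ = d)).symm

theorem oneOrbitCount_recurrence (n : ℕ) :
    oneOrbitCount (n + 1) 0 = oneOrbitCount n 0 ∧
    ∀ d, (oneOrbitCount (n + 1) (d + 1) : ℤ) =
      (d + 2) * oneOrbitCount n (d + 1) + ((n : ℤ) - d) * oneOrbitCount n d := by
  have h := card_insertion_recurrence (insertAt_bijective n) (δ := fun φ => desTail φ.1)
    (ε := fun ψ => desTail ψ.1) (fun t φ => desTail_insertAt_eq_or φ.1 t)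
    (fun φ => card_desTail_insertAt_eq φ.1)
  simp only [oneOrbitCount_eq_card]
  refine ⟨h.1, fun d => (h.2 d).trans ?_⟩
  push_cast
  ring

theorem oneOrbit_of_fin_one (φ : Perm (Fin 1)) : OneOrbit φ := fun i j => by
  have hij : i = j := Subsingleton.elim (α := Fin 1) i j
  rw [hij]

theorem oneOrbitCount_eq_eulerian (n : ℕ) : ∀ d, oneOrbitCount n d = eulerian n d := by
  induction n with
  | zero =>
    intro d
    refine Nat.card_congr (((Equiv.ofUnique (Perm (Fin 1)) (Perm (Fin 0))).subtypeEquiv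
      fun φ => ?_))
    rw [desTail_eq_descents, card_Des, descents_of_le_one zero_le_one,
      descents_of_le_one zero_le_one]
    exact and_iff_right (oneOrbit_of_fin_one φ)
  | succ n ih =>
    intro d
    cases d with
    | zero => rw [(oneOrbitCount_recurrence n).1, (eulerian_recurrence n).1, ih]
    | succ d =>
      have h := (oneOrbitCount_recurrence n).2 d
      rw [ih, ih, ← (eulerian_recurrence n).2 d] at h
      exact_mod_cast h

theorem eulerian_one (d : ℕ) : eulerian 1 d = if d = 0 then 1 else 0 := by
  have h (π : Perm (Fin 1)) : (Des π).card = 0 := descents_of_le_one le_rfl π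
  split_ifs with hd
  · simp [eulerian, h, hd]
  · simp [eulerian, h, Ne.symm hd]

/-- Every one-orbit permutation of `Fin (n + 1)` arises from exactly one sequence of insertions. -/
theorem card_oneOrbit (n : ℕ) :
    Nat.card {φ : Perm (Fin (n + 1)) // OneOrbit φ} = n.factorial := by
  induction n with
  | zero =>
    rw [Nat.card_congr (Equiv.subtypeUnivEquiv oneOrbit_of_fin_one)]
    simp
  | succ n ih =>
    rw [← Nat.card_congr (Equiv.ofBijective _ (insertAt_bijective n)), Nat.card_prod, ih,
      Nat.card_fin, Nat.factorial_succ]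

/-! ### From suffix arrays to one-orbit permutations -/

/-- The rank of the suffix that starts at a given position, when `π` is the suffix array. The empty
suffix, at position `n`, takes part and has rank `0`; the nonempty ones have the ranks
`1, …, n`. -/
def rank {n : ℕ} (π : Perm (Fin n)) : Perm (Fin (n + 1)) :=
  (finSuccEquivLast.trans (optionCongr π.symm)).trans (finSuccEquiv n).symm

theorem rank_last {n : ℕ} (π : Perm (Fin n)) : rank π (Fin.last n) = 0 := by
  simp [rank, -optionCongr_symm]

theorem rank_castSucc {n : ℕ} (π : Perm (Fin n)) (j : Fin n) :
    rank π j.castSucc = (π.symm j).succ := by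
  simp [rank, -optionCongr_symm]

/-- The permutation of the ranks that belongs to the removal of the first letter of a suffix; the
empty suffix is followed by the whole word. -/
def rankStep {n : ℕ} (π : Perm (Fin n)) : Perm (Fin (n + 1)) :=
  rank π * finRotate (n + 1) * (rank π)⁻¹

theorem finRotate_castSucc {n : ℕ} (j : Fin n) : finRotate (n + 1) j.castSucc = j.succ := by
  simp

theorem rankStep_rank {n : ℕ} (π : Perm (Fin n)) (j : Fin (n + 1)) :
    rankStep π (rank π j) = rank π (finRotate (n + 1) j) := by
  simp [rankStep]

theorem rankStep_succ {n : ℕ} (π : Perm (Fin n)) (i : Fin n) :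
    rankStep π i.succ = rank π (π i).succ := by
  have h := rankStep_rank π (π i).castSucc
  rwa [rank_castSucc, Equiv.symm_apply_apply, finRotate_castSucc] at h

theorem oneOrbit_finRotate (n : ℕ) : OneOrbit (finRotate (n + 1)) := by
  have h (i : Fin (n + 1)) : (finRotate (n + 1)).SameCycle 0 i := by
    induction i using Fin.induction with
    | zero => exact Perm.SameCycle.refl _ _
    | succ i ih =>
      rw [← finRotate_castSucc]
      exact Perm.sameCycle_apply_right.2 ih
  exact fun i j => (h i).symm.trans (h j)

theorem oneOrbit_rankStep {n : ℕ} (π : Perm (Fin n)) : OneOrbit (rankStep π) := fun _ _ =>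
  Perm.sameCycle_conj.2 (oneOrbit_finRotate n _ _)

theorem rankStep_injective (n : ℕ) : Function.Injective (rankStep (n := n)) := by
  intro π σ h
  -- the ranks are read off by following `rankStep` from the rank `0` of the empty suffix
  have hr (j : Fin (n + 1)) : rank π j = rank σ j := by
    induction j using Fin.induction with
    | zero =>
      have hπ := rankStep_rank π (Fin.last n)
      have hσ := rankStep_rank σ (Fin.last n)
      rw [rank_last, finRotate_last] at hπ hσ
      rw [← hπ, ← hσ, h]
    | succ j ih =>
      rw [← finRotate_castSucc, ← rankStep_rank, ← rankStep_rank, ih, h]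
  have hinv : π.symm = σ.symm := Equiv.ext fun j => by
    simpa only [rank_castSucc, Fin.succ_inj] using hr j.castSucc
  exact Equiv.symm_bijective.injective hinv

theorem rankStep_bijective (n : ℕ) : Function.Bijective fun π : Perm (Fin n) =>
    (⟨rankStep π, oneOrbit_rankStep π⟩ : {φ : Perm (Fin (n + 1)) // OneOrbit φ}) := by
  rw [Nat.bijective_iff_injective_and_card]
  refine ⟨fun π σ h => rankStep_injective n (congrArg Subtype.val h), ?_⟩
  rw [card_oneOrbit, Nat.card_perm, Nat.card_fin]

theorem card_desTail_rankStep (n d : ℕ) :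
    Nat.card {π : Perm (Fin n) // desTail (rankStep π) = d} = oneOrbitCount n d := by
  rw [oneOrbitCount_eq_card]
  exact Nat.card_congr ((Equiv.ofBijective _ (rankStep_bijective n)).subtypeEquiv fun _ => Iff.rfl)

/-! ### The words with a given suffix array -/

theorem suffix_eq_cons {α : Type*} {n : ℕ} (w : Fin n → α) (j : Fin n) :
    suffix w j = w j :: (List.ofFn w).drop (j.succ : Fin (n + 1)) := by
  rw [suffix, List.drop_eq_getElem_cons (by simp)]
  simp

/-- The order of two suffixes is decided by their first letters and, where these agree, by the
ranks of the rests. -/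
theorem isSuffixArray_iff {α : Type*} [LinearOrder α] {n : ℕ} (w : Fin n → α) (π : Perm (Fin n)) :
    IsSuffixArray w π ↔ ∀ i i', i < i' → w (π i) < w (π i') ∨
      w (π i) = w (π i') ∧ rank π (π i).succ < rank π (π i').succ := by
  constructor
  · intro h i i' hi
    -- on all positions, that of the empty suffix included, the ranks follow the order of suffixes
    have hmono : StrictMono fun r => (List.ofFn w).drop ((rank π).symm r : Fin (n + 1)) := by
      have hs (k : Fin n) : (rank π).symm k.succ = (π k).castSucc := by
        rw [Equiv.symm_apply_eq, rank_castSucc, Equiv.symm_apply_apply]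
      have h0 : (rank π).symm 0 = Fin.last n := by
        rw [Equiv.symm_apply_eq, rank_last]
      intro r r' hr
      obtain ⟨k', rfl⟩ := Fin.exists_succ_eq.2 (Fin.ne_zero_of_lt hr)
      induction r using Fin.cases with
      | zero =>
        have hd : (List.ofFn w).drop (Fin.last n : Fin (n + 1)) = [] := by simp
        have hc := suffix_eq_cons w (π k')
        rw [suffix] at hc
        simp only [h0, hs, hd, Fin.val_castSucc, hc]
        exact List.nil_lt_cons _ _
      | succ k =>
        simp only [hs]
        exact h (Fin.succ_lt_succ_iff.1 hr)
    have hlt : suffix w (π i) < suffix w (π i') := h hi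
    rw [suffix_eq_cons, suffix_eq_cons, List.cons_lt_cons_iff] at hlt
    refine hlt.imp_right fun ⟨h₁, h₂⟩ => ⟨h₁, ?_⟩
    rw [← hmono.lt_iff_lt]
    simpa using h₂
  · intro h
    have key (m : ℕ) : ∀ j j' : Fin (n + 1), n - (j : ℕ) = m → rank π j < rank π j' →
        (List.ofFn w).drop j < (List.ofFn w).drop j' := by
      induction m with
      | zero =>
        intro j j' hj hlt
        obtain rfl : j = Fin.last n := Fin.ext (by have := j.2; simp; omega)
        induction j' using Fin.lastCases with
        | last => exact absurd hlt (lt_irrefl _)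
        | cast j' =>
          have hd : (List.ofFn w).drop (Fin.last n : Fin (n + 1)) = [] := by simp
          have hc := suffix_eq_cons w j'
          rw [suffix] at hc
          rw [hd, Fin.val_castSucc, hc]
          exact List.nil_lt_cons _ _
      | succ m ih =>
        intro j j' hj hlt
        induction j using Fin.lastCases with
        | last => simp at hj
        | cast j =>
          induction j' using Fin.lastCases with
          | last =>
            rw [rank_last] at hlt
            exact absurd hlt (Fin.not_lt_zero _)
          | cast j' =>
            rw [rank_castSucc, rank_castSucc, Fin.succ_lt_succ_iff] at hlt
            have h' := h _ _ hlt
            rw [Equiv.apply_symm_apply, Equiv.apply_symm_apply] at h'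
            have hc := suffix_eq_cons w j
            have hc' := suffix_eq_cons w j'
            rw [suffix] at hc hc'
            rw [Fin.val_castSucc, Fin.val_castSucc, hc, hc', List.cons_lt_cons_iff]
            refine h'.imp_right fun ⟨h₁, h₂⟩ => ⟨h₁, ih _ _ ?_ h₂⟩
            rw [Fin.val_castSucc] at hj
            rw [Fin.val_succ]
            omega
    intro i i' hi
    exact key _ (π i).castSucc (π i').castSucc rfl (by simpa [rank_castSucc] using hi)

/-- The number of descents of the sequence `f` before the position `i`. -/
def descentsBefore {L : Type*} [LinearOrder L] {n : ℕ} (f : Fin n → L) (i : ℕ) : ℕ :=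
  (Finset.univ.filter fun l : Fin n => (l : ℕ) < i ∧ ∃ h : (l : ℕ) + 1 < n, f ⟨l + 1, h⟩ < f l).card

theorem descentsBefore_mono {L : Type*} [LinearOrder L] {n : ℕ} (f : Fin n → L) :
    Monotone (descentsBefore f) := fun _ _ h =>
  Finset.card_le_card (Finset.monotone_filter_right _ fun _ _ hl => ⟨hl.1.trans_le h, hl.2⟩)

theorem descentsBefore_le {L : Type*} [LinearOrder L] {n : ℕ} (f : Fin n → L) (i : ℕ) :
    descentsBefore f i ≤ descents f :=
  Finset.card_le_card (Finset.monotone_filter_right _ fun _ _ hl => hl.2)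

theorem descentsBefore_zero {L : Type*} [LinearOrder L] {n : ℕ} (f : Fin n → L) :
    descentsBefore f 0 = 0 := by
  simp [descentsBefore]

theorem descentsBefore_last {L : Type*} [LinearOrder L] {n : ℕ} (f : Fin (n + 1) → L) :
    descentsBefore f n = descents f := by
  refine congrArg Finset.card (Finset.filter_congr fun l _ => ?_)
  exact and_iff_right_of_imp fun ⟨h, _⟩ => by omega

theorem descentsBefore_succ {L : Type*} [LinearOrder L] {n i : ℕ} (f : Fin n → L)
    (hi : i + 1 < n) : descentsBefore f (i + 1) =
      descentsBefore f i + if f ⟨i + 1, hi⟩ < f ⟨i, i.lt_succ_self.trans hi⟩ then 1 else 0 := by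
  have h (l : Fin n) : ((l : ℕ) < i + 1 ∧ ∃ h : (l : ℕ) + 1 < n, f ⟨l + 1, h⟩ < f l) ↔
      ((l : ℕ) < i ∧ ∃ h : (l : ℕ) + 1 < n, f ⟨l + 1, h⟩ < f l) ∨
        (l = ⟨i, i.lt_succ_self.trans hi⟩ ∧
          f ⟨i + 1, hi⟩ < f ⟨i, i.lt_succ_self.trans hi⟩) := by
    rw [Nat.lt_succ_iff_lt_or_eq, or_and_right, Fin.ext_iff]
    refine or_congr_right (and_congr_right fun hl => ?_)
    obtain rfl : l = ⟨i, i.lt_succ_self.trans hi⟩ := Fin.ext hl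
    exact exists_prop_of_true hi
  simp only [descentsBefore, h]
  rw [Finset.filter_or, Finset.card_union_of_disjoint]
  · congr 1
    split_ifs with hd <;> simp [hd, Finset.filter_eq']
  · refine Finset.disjoint_filter.2 ?_
    rintro l - ⟨hl, -⟩ ⟨rfl, -⟩
    exact lt_irrefl _ hl

/-- Between two positions with the same number of preceding descents the sequence does not
decrease. -/
theorem le_of_descentsBefore_eq {L : Type*} [LinearOrder L] {n : ℕ} (f : Fin n → L) {i i' : ℕ}
    (hi : i ≤ i') (hi' : i' < n) (h : descentsBefore f i = descentsBefore f i') :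
    f ⟨i, hi.trans_lt hi'⟩ ≤ f ⟨i', hi'⟩ := by
  induction i', hi using Nat.le_induction with
  | base => exact le_rfl
  | succ m hm ih =>
    have h₁ := descentsBefore_mono f hm
    have h₂ := descentsBefore_succ f hi'
    have h₃ : ¬ f ⟨m + 1, hi'⟩ < f ⟨m, m.lt_succ_self.trans hi'⟩ := by
      intro hlt
      rw [if_pos hlt] at h₂
      omega
    rw [if_neg h₃, add_zero] at h₂
    exact (ih _ (h.trans h₂)).trans (not_lt.1 h₃)

/-- In a word with suffix array `π`, the first letters of the sorted suffixes increase weakly, and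
they have to increase strictly at the descents of the sequence of the ranks of the rests. Taking as
first letter the number of preceding descents meets these conditions with as few letters as
possible. -/
theorem exists_isSuffixArray_iff {α : Type*} [LinearOrder α] [Fintype α] {n : ℕ}
    (hn : 0 < n ∨ 0 < Fintype.card α) (π : Perm (Fin n)) :
    (∃ w : Fin n → α, IsSuffixArray w π) ↔ desTail (rankStep π) < Fintype.card α := by
  rw [desTail_eq_descents]
  set f : Fin n → Fin (n + 1) := fun i => rankStep π i.succ with hf
  have hfr (i : Fin n) : rank π (π i).succ = f i := (rankStep_succ π i).symm
  let e := Fintype.orderIsoFinOfCardEq α rfl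
  simp only [isSuffixArray_iff, hfr]
  constructor
  · rintro ⟨w, hw⟩
    cases n with
    | zero =>
      rw [descents_of_le_one zero_le_one]
      exact hn.resolve_left (lt_irrefl _)
    | succ n =>
      have hv (i : ℕ) (hi : i < n + 1) : descentsBefore f i ≤ e.symm (w (π ⟨i, hi⟩)) := by
        induction i with
        | zero =>
          rw [descentsBefore_zero]
          exact Nat.zero_le _
        | succ i ih =>
          have ih' := ih (by omega)
          rw [descentsBefore_succ f hi]
          rcases hw ⟨i, by omega⟩ ⟨i + 1, hi⟩ (Fin.mk_lt_mk.2 i.lt_succ_self) with h | ⟨h, h'⟩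
          · have h'' := Fin.lt_def.1 (e.symm.lt_iff_lt.2 h)
            split_ifs <;> omega
          · rw [if_neg h'.not_gt, ← h]
            exact ih'
      rw [← descentsBefore_last]
      exact (hv n n.lt_succ_self).trans_lt (Fin.is_lt _)
  · intro h
    refine ⟨fun j => e ⟨descentsBefore f (π.symm j), (descentsBefore_le f _).trans_lt h⟩,
      fun i i' hi => ?_⟩
    simp only [Equiv.symm_apply_apply, e.lt_iff_lt, e.apply_eq_iff_eq, Fin.mk_lt_mk, Fin.mk.injEq]
    rcases (descentsBefore_mono f hi.le).lt_or_eq with hlt | heq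
    · exact Or.inl hlt
    · refine Or.inr ⟨heq, lt_of_le_of_ne (le_of_descentsBefore_eq f hi.le i'.2 heq) ?_⟩
      exact (rankStep π).injective.ne (Fin.succ_injective _ |>.ne hi.ne)

theorem card_lt_eq_sum {X : Type*} [Finite X] (δ : X → ℕ) (k : ℕ) :
    Nat.card {x // δ x < k} = ∑ d ∈ Finset.range k, Nat.card {x // δ x = d} := by
  classical
  have := Fintype.ofFinite X
  simp only [Nat.card_eq_fintype_card, Fintype.card_subtype]
  rw [Finset.card_eq_sum_card_fiberwise (f := δ) (t := Finset.range k)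
    fun x hx => by simpa using hx]
  refine Finset.sum_congr rfl fun d hd => ?_
  rw [Finset.filter_filter]
  refine congrArg Finset.card (Finset.filter_congr fun x _ => ?_)
  exact and_iff_right_of_imp fun h => h ▸ Finset.mem_range.1 hd

theorem card_exists_isSuffixArray {α : Type*} [LinearOrder α] [Fintype α] {n : ℕ}
    (hn : 0 < n ∨ 0 < Fintype.card α) :
    Nat.card {π : Perm (Fin n) // ∃ w : Fin n → α, IsSuffixArray w π} =
      ∑ d ∈ Finset.range (Fintype.card α), eulerian n d := by
  simp only [exists_isSuffixArray_iff hn]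
  rw [card_lt_eq_sum]
  exact Finset.sum_congr rfl fun d _ =>
    (card_desTail_rankStep n d).trans (oneOrbitCount_eq_eulerian n d)

end SuffixArrays

theorem mainTheorem6 {α : Type*} [LinearOrder α] [Fintype α] (n k : ℕ)
    (hk : Fintype.card α = k) (hnk : 0 < n ∨ 0 < k) :
    -- the number of suffix arrays of words of length `n` over a `k`-letter alphabet
    Nat.card {π : Equiv.Perm (Fin n) // ∃ w : Fin n → α, SuffixArrays.IsSuffixArray w π} =
      ∑ d ∈ Finset.range k, SuffixArrays.eulerian n d ∧
    -- the one-orbit permutations are counted by the Eulerian numbers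
    (∀ d, SuffixArrays.oneOrbitCount n d = SuffixArrays.eulerian n d) ∧
    -- initial values and Eulerian recurrence for the one-orbit permutations
    (∀ d, SuffixArrays.oneOrbitCount 1 d = if d = 0 then 1 else 0) ∧
    SuffixArrays.oneOrbitCount (n + 1) 0 = SuffixArrays.oneOrbitCount n 0 ∧
    (∀ d, (SuffixArrays.oneOrbitCount (n + 1) (d + 1) : ℤ) =
      (d + 2) * SuffixArrays.oneOrbitCount n (d + 1) +
        ((n : ℤ) - d) * SuffixArrays.oneOrbitCount n d) ∧
    -- the insertion maps produce every one-orbit permutation exactly once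
    Set.BijOn
      (fun p : Fin (n + 2) × Equiv.Perm (Fin (n + 1)) => SuffixArrays.insertAt p.1 p.2)
      {p | p.1 ≠ 0 ∧ SuffixArrays.OneOrbit p.2} {ψ | SuffixArrays.OneOrbit ψ} ∧
    -- and their effect on the number of descents
    (∀ φ : Equiv.Perm (Fin (n + 1)), SuffixArrays.OneOrbit φ →
      (∀ s : Fin (n + 2), s ≠ 0 →
        SuffixArrays.desTail (SuffixArrays.insertAt s φ) = SuffixArrays.desTail φ ∨
        SuffixArrays.desTail (SuffixArrays.insertAt s φ) = SuffixArrays.desTail φ + 1) ∧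
      Nat.card {s : Fin (n + 2) //
        s ≠ 0 ∧ SuffixArrays.desTail (SuffixArrays.insertAt s φ) = SuffixArrays.desTail φ} =
        SuffixArrays.desTail φ + 1) := by
  subst hk
  refine ⟨SuffixArrays.card_exists_isSuffixArray hnk, SuffixArrays.oneOrbitCount_eq_eulerian n,
    fun d => (SuffixArrays.oneOrbitCount_eq_eulerian 1 d).trans (SuffixArrays.eulerian_one d),
    (SuffixArrays.oneOrbitCount_recurrence n).1, (SuffixArrays.oneOrbitCount_recurrence n).2,
    SuffixArrays.insertAt_bijOn n, fun φ _ => ⟨fun s hs => ?_, ?_⟩⟩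
  · obtain ⟨t, rfl⟩ := Fin.exists_succ_eq.2 hs
    exact SuffixArrays.desTail_insertAt_eq_or φ t
  · rw [← SuffixArrays.card_desTail_insertAt_eq φ, Nat.card_eq_fintype_card, Fintype.card_subtype,
      Finset.card_filter, Fin.sum_univ_succ, Finset.card_filter]
    simp [Fin.succ_ne_zero]
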